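/- Consider a gossip network with a source and $n\ge 2$ nodes. Let $\lambda_e,\lambda>0$ and let the following events occur according to independent Poisson processes: the source updates itself at rate $\lambda_e$; the source sends an update to each node at rate $\lambda/n$; in the fully connected (FC) topology each node $i$ sends a gossip update to each other node $j$ at rate $\lambda/(n-1)$, while in the disconnected (DC) topology there is no gossip; and each unordered pair of distinct entities among the source and the nodes meets (contact mobility) at rate $\lambda/f(n)$. The version age $X_i(t)\in\{0,1,2,\dots\}$ of node $i$ is the number of versions by which it is behind the source, and the source has age $0$. All ages increase by $1$ when the source updates itself; an update from the source to node $j$ sets $X_j$ to $0$; a gossip update from $i$ to $j$ replaces $X_j$ by $\min\{X_i,X_j\}$; and when two entities meet, the ages of both become the minimum of the two. Initial ages are arbitrary with finite mean. Then, for both the DC and the FC topology and for each of the choices of $f$ below, the limit $\tilde v_1=\lim_{t\to\infty}\mathbb E[X_i(t)]$ (the steady-state average version age of a single node) exists and is finite for every node $i$, and it depends neither on $i$ nor on the initial ages. For fixed $\lambda_e,\lambda$ and fixed $c>0$, as $n\to\infty$, $$\tilde v_1=\mathcal O(\ln n)\ \text{ if } f(n)=n,\qquad \tilde v_1=\mathcal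 O\!\left(\frac{(\ln n)^2}{n}\right)\ \text{ if } f(n)=c\ln n,\qquad \tilde v_1=\mathcal O\!\left(\frac{\ln n}{n}\right)\ \text{ if } f(n)=c .$$ Moreover, for both topologies and every $n\ge 2$, $\tilde v_1\le K/\lambda$, where $$K=\begin{cases}\lambda_e(\ln n+1), & f(n)=n,\\[2pt] \dfrac{c\lambda_e(\ln n)^2}{n}+\dfrac{c\lambda_e\ln n}{n}+\dfrac{c\lambda_e\ln n}{n(n+c\ln n)}, & f(n)=c\ln n,\\[6pt] \dfrac{c\lambda_e(\ln n+1)}{n}+\dfrac{c\lambda_e}{n(c+n)}, & f(n)=c.\end{cases}$$ -/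

import Mathlib

open MeasureTheory ProbabilityTheory Filter Topology Asymptotics
open scoped NNReal

universe u

/-- The types of events in a gossip network with contact mobility on the nodes `Fin n`
(the source is a separate entity, whose version age is always `0`). -/
inductive GossipEvent (n : ℕ) : Type
  /-- the source obtains a new version -/
  | selfUpdate : GossipEvent n
  /-- the source pushes its version to node `j` -/
  | push (j : Fin n) : GossipEvent n
  /-- node `i` sends its version to node `j` -/
  | gossip (i j : Fin n) (h : i ≠ j) : GossipEvent n
  /-- the source and node `j` meet -/
  | sourceContact (j : Fin n) : GossipEvent n
  /-- the nodes `i` and `j` meet; every unordered pair of distinct nodes occurs once -/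
  | contact (i j : Fin n) (h : i < j) : GossipEvent n

/-- The effect of an event on the vector of version ages. -/
def GossipEvent.transition {n : ℕ} : GossipEvent n → (Fin n → ℕ) → (Fin n → ℕ)
  | .selfUpdate, x => fun l => x l + 1
  | .push j, x => fun l => if l = j then 0 else x l
  | .gossip i j _, x => fun l => if l = j then min (x j) (x i) else x l
  | .sourceContact j, x => fun l => if l = j then 0 else x l
  | .contact i j _, x => fun l => if l = i ∨ l = j then min (x i) (x j) else x l

/-- The two network topologies: without any gossip link, and with all gossip links. -/
inductive GossipTopology : Type
  | disconnected : GossipTopology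
  | fullyConnected : GossipTopology

/-- The graph of gossip links of a topology on `n` nodes. -/
def GossipTopology.graph (T : GossipTopology) (n : ℕ) : SimpleGraph (Fin n) :=
  match T with
  | .disconnected => ⊥
  | .fullyConnected => ⊤

open Classical in
/-- The symmetric rates on `n` nodes with gossip links `G`: the source updates itself at rate `le`,
pushes to each node at rate `l / n`, a node gossips to each of its neighbours at rate
`l / (n - 1)`, and every two of the `n + 1` entities (the source and the nodes) meet at
rate `l / fn`. -/
noncomputable def symmetricRate {n : ℕ} (G : SimpleGraph (Fin n)) (le l fn : ℝ) :
    GossipEvent n → ℝ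
  | .selfUpdate => le
  | .push _ => l / n
  | .gossip i j _ => if G.Adj i j then l / ((n : ℝ) - 1) else 0
  | .sourceContact _ => l / fn
  | .contact _ _ _ => l / fn

/-- `N e`, for `e : E`, are independent Poisson processes of rates `rate e` (a process of rate `0`
has no events) relative to the filtration `ℱ`: they are adapted càdlàg counting processes whose
increments over `(s, t]` are Poisson with mean `rate e * (t - s)`, independent of each other, and
jointly independent of `ℱ s`. -/
structure IsPoissonFamily {Ω E : Type*} [mΩ : MeasurableSpace Ω] (P : Measure Ω)
    (ℱ : Filtration ℝ≥0 mΩ) (rate : E → ℝ) (N : E → ℝ≥0 → Ω → ℕ) : Prop where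
  adapted : ∀ e, Adapted ℱ (N e)
  zero : ∀ᵐ ω ∂P, ∀ e, N e 0 ω = 0
  mono : ∀ᵐ ω ∂P, ∀ e, Monotone fun t => N e t ω
  rightContinuous : ∀ᵐ ω ∂P, ∀ e, ∀ t, ContinuousWithinAt (fun u => N e u ω) (Set.Ici t) t
  law : ∀ e, ∀ s t : ℝ≥0, s ≤ t →
    P.map (fun ω => N e t ω - N e s ω) = poissonMeasure (rate e * ((t : ℝ) - s)).toNNReal
  indep : ∀ s t : ℝ≥0, s ≤ t → iIndepFun (fun e ω => N e t ω - N e s ω) P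
  indep_past : ∀ s t : ℝ≥0, s ≤ t →
    Indep (MeasurableSpace.comap (fun ω e => N e t ω - N e s ω) inferInstance) (ℱ s) P

/-- `X t ω i` is the version age of node `i` at time `t` in a network whose events of type `e`
occur at the jump times of `N e`, where the `N e` are independent Poisson processes of rates
`rate e`. The initial ages are arbitrary with finite mean. -/
structure IsVersionAgeProcess {Ω : Type*} [mΩ : MeasurableSpace Ω] {n : ℕ}
    (rate : GossipEvent n → ℝ) (P : Measure Ω) (ℱ : Filtration ℝ≥0 mΩ)
    (N : GossipEvent n → ℝ≥0 → Ω → ℕ) (X : ℝ≥0 → Ω → Fin n → ℕ) : Prop where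
  poisson : IsPoissonFamily P ℱ rate N
  adapted : Adapted ℱ X
  integrable_init : ∀ i, Integrable (fun ω => (X 0 ω i : ℝ)) P
  /-- the ages do not change over a time interval `(s, t]` without events -/
  no_event : ∀ᵐ ω ∂P, ∀ s t : ℝ≥0, s ≤ t → (∀ e, N e t ω = N e s ω) → X t ω = X s ω
  /-- a single event in `(s, t]` changes the ages by the corresponding transition (almost surely,
  events do not coincide and are finitely many in bounded time, so this determines `X`) -/
  one_event : ∀ᵐ ω ∂P, ∀ s t : ℝ≥0, s ≤ t → ∀ e, N e t ω = N e s ω + 1 →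
    (∀ e', e' ≠ e → N e' t ω = N e' s ω) → X t ω = e.transition (X s ω)

/-- `v` is the steady-state average version age of every single node in the network with event
rates `rate`: whatever the realization and the initial ages, the version age of each node has finite
mean at all times, and this mean converges to `v` as time goes to infinity. -/
def IsSteadyStateAge {n : ℕ} (rate : GossipEvent n → ℝ) (v : ℝ) : Prop :=
  ∀ (Ω : Type u) (mΩ : MeasurableSpace Ω) (P : Measure Ω) (_ : IsProbabilityMeasure P)
    (ℱ : Filtration ℝ≥0 mΩ) (N : GossipEvent n → ℝ≥0 → Ω → ℕ) (X : ℝ≥0 → Ω → Fin n → ℕ),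
    IsVersionAgeProcess rate P ℱ N X → ∀ i : Fin n,
      (∀ t, Integrable (fun ω => (X t ω i : ℝ)) P) ∧
      Tendsto (fun t => ∫ ω, (X t ω i : ℝ) ∂P) atTop (𝓝 v)

/-! The idea is to follow the smallest age over a nonempty set `S` of nodes, since the means of
these minima satisfy a closed system. A self-update raises the minimum by 1, a visit of the source
to `S` resets it to 0, and news from a node `i` outside `S` turns it into the minimum over `insert i
S`. With `a = l / n + l / fn` the rate from the source to a node, `b` the rate from one node to
another (gossip plus contact) and `m = n - |S|`, the mean `v_S` satisfies `v_S' = le - |S| (a + m b)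
v_S + |S| b ∑_{i ∉ S} v_{S ∪ {i}}`. The equation comes from a short-time expansion,
`abs_integral_minAge_sub_le`, with `sum_symmetricRate_mul` computing the generator. It is a stable
linear equation whose forcing involves only larger sets. Starting from the set of all nodes,
induction on `m` shows that every `v_S` converges, to a limit `w_m` that depends on `m` alone
(`tendsto_integral_minAge`); singletons are the case `m = n - 1`.

For the bound, let `q = l / fn`. Since `w_m` increases with `m`, discarding pushes and gossip from
the recursion leaves `(m + 2) q w_{m+1} ≤ (m + 1) q w_m + le / (n - m - 1)`. This telescopes to `n q
w_{n-1} ≤ le * harmonic n ≤ le (1 + log n)` (`contact_mul_steadyMinAge_le`, `steadyAge_le`). Both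
topologies and all three choices of `f` follow from this single estimate. -/

/-! ### Mean of the Poisson law -/

lemma hasSum_mul_poisson (r : ℝ≥0) :
    HasSum (fun n : ℕ => Real.exp (-r) * (r : ℝ) ^ n / n.factorial * n) r := by
  have h := (hasSum_one_poissonMeasure r).mul_left (r : ℝ)
  rw [mul_one] at h
  -- The term at 0 vanishes, and the term at `n + 1` is `r` times the Poisson weight of `n`.
  rw [← hasSum_nat_add_iff' 1]
  simp only [Finset.range_one, Finset.sum_singleton, CharP.cast_eq_zero, mul_zero, sub_zero]
  refine h.congr_fun ?_ |> id
  intro n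
  have : (n.factorial : ℝ) ≠ 0 := by positivity
  rw [Nat.factorial_succ]
  push_cast
  field_simp
  ring

lemma integrable_id_poissonMeasure (r : ℝ≥0) :
    Integrable (fun n : ℕ => (n : ℝ)) (poissonMeasure r) := by
  rw [integrable_poissonMeasure_iff]
  simpa using (hasSum_mul_poisson r).summable

lemma integral_id_poissonMeasure (r : ℝ≥0) : ∫ n : ℕ, (n : ℝ) ∂(poissonMeasure r) = r := by
  rw [integral_poissonMeasure]
  simpa using (hasSum_mul_poisson r).tsum_eq

/-! ### Event counts of a Poisson family over a short interval -/

section Increments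

variable {Ω E : Type*} {mΩ : MeasurableSpace Ω} {P : Measure Ω}
  {ℱ : Filtration ℝ≥0 mΩ} {rate : E → ℝ} {N : E → ℝ≥0 → Ω → ℕ}

/-- The numbers of events of each type in the time interval `(s, t]`. -/
def eventCount (N : E → ℝ≥0 → Ω → ℕ) (s t : ℝ≥0) (ω : Ω) : E → ℕ :=
  fun e => N e t ω - N e s ω

open Classical in
/-- There is exactly one event in the time interval `(s, t]`, and it is of type `e`. -/
def singleEvent (N : E → ℝ≥0 → Ω → ℕ) (s t : ℝ≥0) (e : E) : Set Ω :=
  eventCount N s t ⁻¹' {Pi.single e 1}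

/-- There is no event in the time interval `(s, t]`. -/
def noEvents (N : E → ℝ≥0 → Ω → ℕ) (s t : ℝ≥0) : Set Ω :=
  eventCount N s t ⁻¹' {0}

/-- There are at least two events in the time interval `(s, t]`. -/
def manyEvents (N : E → ℝ≥0 → Ω → ℕ) (s t : ℝ≥0) : Set Ω :=
  (noEvents N s t ∪ ⋃ e, singleEvent N s t e)ᶜ

lemma disjoint_singleEvent (N : E → ℝ≥0 → Ω → ℕ) (s t : ℝ≥0) :
    Pairwise (Function.onFun Disjoint (singleEvent N s t)) := by
  classical
  intro e e' hee
  refine Disjoint.preimage _ (Set.disjoint_singleton.2 fun h => hee ?_)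
  by_contra
  have := congrFun h e
  simp [hee] at this

lemma disjoint_noEvents_singleEvent (N : E → ℝ≥0 → Ω → ℕ) (s t : ℝ≥0) (e : E) :
    Disjoint (noEvents N s t) (singleEvent N s t e) := by
  classical
  refine Disjoint.preimage _ (Set.disjoint_singleton.2 fun h => ?_)
  have := congrFun h e
  simp at this

namespace IsPoissonFamily

lemma measurable_count (h : IsPoissonFamily P ℱ rate N) (s t : ℝ≥0) (e : E) :
    Measurable fun ω => N e t ω - N e s ω :=
  (((h.adapted e) t).mono (ℱ.le t) le_rfl).sub (((h.adapted e) s).mono (ℱ.le s) le_rfl)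

lemma measurable_eventCount (h : IsPoissonFamily P ℱ rate N) (s t : ℝ≥0) :
    Measurable (eventCount N s t) :=
  measurable_pi_lambda _ fun e => h.measurable_count s t e

lemma integrable_count (h : IsPoissonFamily P ℱ rate N) {s t : ℝ≥0} (hst : s ≤ t) (e : E) :
    Integrable (fun ω => (eventCount N s t ω e : ℝ)) P := by
  have h1 := integrable_id_poissonMeasure (rate e * ((t : ℝ) - s)).toNNReal
  rw [← h.law e s t hst] at h1
  exact h1.comp_measurable (h.measurable_count s t e)

lemma integral_count (h : IsPoissonFamily P ℱ rate N) {s t : ℝ≥0} (hst : s ≤ t) (e : E)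
    (he : 0 ≤ rate e) :
    ∫ ω, (eventCount N s t ω e : ℝ) ∂P = rate e * ((t : ℝ) - s) := by
  have h1 := integral_id_poissonMeasure (rate e * ((t : ℝ) - s)).toNNReal
  rw [← h.law e s t hst, integral_map (h.measurable_count s t e).aemeasurable
    (by fun_prop)] at h1
  rw [Real.coe_toNNReal _ (mul_nonneg he (sub_nonneg.2 (by exact_mod_cast hst)))] at h1
  exact h1

lemma integral_mul_indicator (h : IsPoissonFamily P ℱ rate N) {s t : ℝ≥0} (hst : s ≤ t)
    {Y : Ω → ℝ} (hY : Measurable[ℱ s] Y) {A : Set (E → ℕ)} (hA : MeasurableSet A) :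
    ∫ ω, Y ω * (eventCount N s t ⁻¹' A).indicator 1 ω ∂P =
      (∫ ω, Y ω ∂P) * P.real (eventCount N s t ⁻¹' A) := by
  have hAm := h.measurable_eventCount s t hA
  have hind : IndepFun Y ((eventCount N s t ⁻¹' A).indicator (1 : Ω → ℝ)) P := by
    rw [IndepFun_iff_Indep]
    refine indep_of_indep_of_le_left (indep_of_indep_of_le_right (h.indep_past s t hst).symm ?_)
      hY.comap_le
    have : Measurable[MeasurableSpace.comap (eventCount N s t) inferInstance]
        ((eventCount N s t ⁻¹' A).indicator (1 : Ω → ℝ)) :=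
      ((measurable_one (α := ℝ)).indicator hA).comp (comap_measurable _)
    exact this.comap_le
  rw [hind.integral_fun_mul_eq_mul_integral (hY.mono (ℱ.le s) le_rfl).aestronglyMeasurable
    (measurable_one.indicator hAm).aestronglyMeasurable, integral_indicator_one hAm]

variable [Fintype E]

lemma measureReal_eventCount (h : IsPoissonFamily P ℱ rate N) (hr : ∀ e, 0 ≤ rate e)
    {s t : ℝ≥0} (hst : s ≤ t) (k : E → ℕ) :
    P.real (eventCount N s t ⁻¹' {k}) =
      ∏ e, (Real.exp (-(rate e * ((t : ℝ) - s))) * (rate e * ((t : ℝ) - s)) ^ k e /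
        (k e).factorial) := by
  have h1 : eventCount N s t ⁻¹' {k} = ⋂ e, (fun ω => N e t ω - N e s ω) ⁻¹' {k e} := by
    ext ω
    simp [eventCount, funext_iff]
  rw [h1, measureReal_def, (h.indep s t hst).meas_iInter
    (fun e => ⟨{k e}, measurableSet_singleton _, rfl⟩), ENNReal.toReal_prod]
  refine Finset.prod_congr rfl fun e _ => ?_
  rw [← Measure.map_apply (h.measurable_count s t e) (measurableSet_singleton _),
    h.law e s t hst, ← measureReal_def, poissonMeasure_real_singleton,
    Real.coe_toNNReal _ (mul_nonneg (hr e) (sub_nonneg.2 (by exact_mod_cast hst)))]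

lemma measureReal_noEvents (h : IsPoissonFamily P ℱ rate N) (hr : ∀ e, 0 ≤ rate e)
    {s t : ℝ≥0} (hst : s ≤ t) :
    P.real (noEvents N s t) = Real.exp (-((∑ e, rate e) * ((t : ℝ) - s))) := by
  rw [noEvents, h.measureReal_eventCount hr hst, Finset.sum_mul, ← Finset.sum_neg_distrib,
    Real.exp_sum]
  simp

lemma measureReal_singleEvent (h : IsPoissonFamily P ℱ rate N) (hr : ∀ e, 0 ≤ rate e)
    {s t : ℝ≥0} (hst : s ≤ t) (e : E) :
    P.real (singleEvent N s t e) =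
      rate e * ((t : ℝ) - s) * Real.exp (-((∑ e, rate e) * ((t : ℝ) - s))) := by
  classical
  rw [singleEvent, h.measureReal_eventCount hr hst, Finset.sum_mul, ← Finset.sum_neg_distrib,
    Real.exp_sum]
  have : ∀ e' : E, Real.exp (-(rate e' * ((t : ℝ) - s))) *
      (rate e' * ((t : ℝ) - s)) ^ (Pi.single e 1 : E → ℕ) e' /
        ((Pi.single e 1 : E → ℕ) e').factorial =
      (if e' = e then rate e' * ((t : ℝ) - s) else 1) *
        Real.exp (-(rate e' * ((t : ℝ) - s))) := by
    intro e'
    by_cases he : e' = e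
    · subst he
      simp [mul_comm]
    · simp [he]
  convert Finset.prod_congr rfl fun e' _ => this e' using 1
  rw [Finset.prod_mul_distrib]
  simp

lemma measurableSet_noEvents (h : IsPoissonFamily P ℱ rate N) (s t : ℝ≥0) :
    MeasurableSet (noEvents N s t) :=
  h.measurable_eventCount s t (measurableSet_singleton _)

lemma measurableSet_singleEvent (h : IsPoissonFamily P ℱ rate N) (s t : ℝ≥0) (e : E) :
    MeasurableSet (singleEvent N s t e) :=
  h.measurable_eventCount s t (measurableSet_singleton _)

lemma measurableSet_manyEvents (h : IsPoissonFamily P ℱ rate N) (s t : ℝ≥0) :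
    MeasurableSet (manyEvents N s t) :=
  ((h.measurableSet_noEvents s t).union
    (MeasurableSet.iUnion fun e => h.measurableSet_singleEvent s t e)).compl

/-- With `x` the mean total count, the probability is `1 - (1 + x) e^{-x}`, and `e^{-x} ≥ 1 - x`
gives the bound `x ^ 2`. -/
lemma measureReal_manyEvents_le [IsProbabilityMeasure P] (h : IsPoissonFamily P ℱ rate N)
    (hr : ∀ e, 0 ≤ rate e) {s t : ℝ≥0} (hst : s ≤ t) :
    P.real (manyEvents N s t) ≤ ((∑ e, rate e) * ((t : ℝ) - s)) ^ 2 := by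
  have hm : MeasurableSet (⋃ e, singleEvent N s t e) :=
    MeasurableSet.iUnion fun e => h.measurableSet_singleEvent s t e
  rw [manyEvents, probReal_compl_eq_one_sub ((h.measurableSet_noEvents s t).union hm),
    measureReal_union (Set.disjoint_iUnion_right.2 fun e =>
      disjoint_noEvents_singleEvent N s t e) hm,
    measureReal_iUnion_fintype (disjoint_singleEvent N s t)
      (fun e => h.measurableSet_singleEvent s t e), h.measureReal_noEvents hr hst]
  simp_rw [h.measureReal_singleEvent hr hst]
  rw [← Finset.sum_mul, ← Finset.sum_mul]
  set x := (∑ e, rate e) * ((t : ℝ) - s) with hx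
  have hx0 : 0 ≤ x := mul_nonneg (Finset.sum_nonneg fun e _ => hr e)
    (sub_nonneg.2 (by exact_mod_cast hst))
  have := Real.one_sub_le_exp_neg x
  nlinarith

end IsPoissonFamily

end Increments

/-! ### Enumeration of the events and their monotonicity -/

/-- The event types as a disjoint sum of index types. -/
def gossipEventEquiv (n : ℕ) : GossipEvent n ≃
    Unit ⊕ Fin n ⊕ {p : Fin n × Fin n // p.1 ≠ p.2} ⊕ Fin n ⊕ {p : Fin n × Fin n // p.1 < p.2} where
  toFun
    | .selfUpdate => .inl ()
    | .push j => .inr (.inl j)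
    | .gossip i j h => .inr (.inr (.inl ⟨(i, j), h⟩))
    | .sourceContact j => .inr (.inr (.inr (.inl j)))
    | .contact i j h => .inr (.inr (.inr (.inr ⟨(i, j), h⟩)))
  invFun
    | .inl _ => .selfUpdate
    | .inr (.inl j) => .push j
    | .inr (.inr (.inl p)) => .gossip p.1.1 p.1.2 p.2
    | .inr (.inr (.inr (.inl j))) => .sourceContact j
    | .inr (.inr (.inr (.inr p))) => .contact p.1.1 p.1.2 p.2
  left_inv e := by cases e <;> rfl
  right_inv e := by rcases e with _ | _ | _ | _ | _ <;> rfl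

instance (n : ℕ) : Fintype (GossipEvent n) := Fintype.ofEquiv _ (gossipEventEquiv n).symm

lemma sum_gossipEvent {n : ℕ} (F : GossipEvent n → ℝ) :
    ∑ e, F e = F .selfUpdate + (∑ j, F (.push j) +
      (∑ p : {p : Fin n × Fin n // p.1 ≠ p.2}, F (.gossip p.1.1 p.1.2 p.2) +
        (∑ j, F (.sourceContact j) +
          ∑ p : {p : Fin n × Fin n // p.1 < p.2}, F (.contact p.1.1 p.1.2 p.2)))) := by
  rw [← (gossipEventEquiv n).symm.sum_comp]
  simp [Fintype.sum_sum_type, gossipEventEquiv]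

lemma GossipEvent.transition_le {n : ℕ} (e : GossipEvent n) (he : e ≠ .selfUpdate)
    (x : Fin n → ℕ) (i : Fin n) : e.transition x i ≤ x i := by
  cases e with
  | selfUpdate => exact absurd rfl he
  | push j => simp only [transition]; split_ifs <;> simp
  | gossip i j h => simp only [transition]; split_ifs with h1 <;> simp [h1]
  | sourceContact j => simp only [transition]; split_ifs <;> simp
  | contact i j h =>
    simp only [transition]
    split_ifs with h1
    · rcases h1 with h1 | h1 <;> simp [h1]
    · simp

/-! ### Ages grow at most by the number of self-updates -/

namespace IsVersionAgeProcess

variable {Ω : Type*} {mΩ : MeasurableSpace Ω} {n : ℕ} {rate : GossipEvent n → ℝ} {P : Measure Ω}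
  {ℱ : Filtration ℝ≥0 mΩ} {N : GossipEvent n → ℝ≥0 → Ω → ℕ} {X : ℝ≥0 → Ω → Fin n → ℕ}

lemma ae_eq_transition (h : IsVersionAgeProcess rate P ℱ N X) :
    ∀ᵐ ω ∂P, ∀ s t : ℝ≥0, s ≤ t → (ω ∈ noEvents N s t → X t ω = X s ω) ∧
      ∀ e, ω ∈ singleEvent N s t e → X t ω = e.transition (X s ω) := by
  classical
  filter_upwards [h.no_event, h.one_event, h.poisson.mono] with ω h0 h1 hm s t hst
  refine ⟨fun hω => h0 s t hst fun e => ?_, fun e hω => h1 s t hst e ?_ fun e' he' => ?_⟩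
  · have := congrFun hω e
    have := hm e hst
    simp only [eventCount, Pi.zero_apply] at *
    omega
  · have := congrFun hω e
    have := hm e hst
    simp only [eventCount, Pi.single_eq_same] at *
    omega
  · have := congrFun hω e'
    have := hm e' hst
    simp only [eventCount, ne_eq, he', not_false_eq_true, Pi.single_eq_of_ne] at *
    omega

/-- Only a self-update can raise an age, and only by 1. The exceptional null set serves all `s`, `t`
at once, and the additive form avoids truncated subtraction, so the bound can be chained along a
partition. -/
lemma ae_add_le_of_notMem_manyEvents (h : IsVersionAgeProcess rate P ℱ N X) :
    ∀ᵐ ω ∂P, ∀ s t : ℝ≥0, s ≤ t → ω ∉ manyEvents N s t → ∀ i,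
      X t ω i + N .selfUpdate s ω ≤ X s ω i + N .selfUpdate t ω := by
  classical
  filter_upwards [h.ae_eq_transition, h.poisson.mono] with ω h1 hm s t hst hω i
  have hms := hm .selfUpdate hst
  simp only at hms
  rw [manyEvents, Set.notMem_compl_iff, Set.mem_union, Set.mem_iUnion] at hω
  rcases hω with hω | ⟨e, hω⟩
  · rw [(h1 s t hst).1 hω]
    omega
  · rw [(h1 s t hst).2 e hω]
    by_cases he : e = .selfUpdate
    · subst he
      have := congrFun hω .selfUpdate
      simp only [eventCount, Pi.single_eq_same] at this
      simp only [GossipEvent.transition]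
      omega
    · have := e.transition_le he (X s ω) i
      omega

/-- Cut `(s, t]` into `m + 1` equal pieces. The bound chains unless some piece has several events,
which has probability at most `(m + 1) * c / (m + 1) ^ 2`; let `m → ∞`. -/
lemma ae_add_le [IsProbabilityMeasure P] (h : IsVersionAgeProcess rate P ℱ N X)
    (hr : ∀ e, 0 ≤ rate e) {s t : ℝ≥0} (hst : s ≤ t) :
    ∀ᵐ ω ∂P, ∀ i, X t ω i + N .selfUpdate s ω ≤ X s ω i + N .selfUpdate t ω := by
  set B : Set Ω := {ω | ¬ ∀ i, X t ω i + N .selfUpdate s ω ≤ X s ω i + N .selfUpdate t ω} with hB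
  set c : ℝ := ((∑ e, rate e) * ((t : ℝ) - s)) ^ 2 with hc
  have key : ∀ m : ℕ, P.real B ≤ c / (m + 1 : ℕ) := by
    intro m
    let p : ℕ → ℝ≥0 := fun k => s + k * ((t - s) / (m + 1 : ℕ))
    have hp0 : p 0 = s := by simp [p]
    have hpm : p (m + 1) = t := by
      simp only [p]
      rw [mul_div_cancel₀ _ (by positivity), add_tsub_cancel_of_le hst]
    have hpk : ∀ k, p (k + 1) = p k + (t - s) / (m + 1 : ℕ) := by
      intro k; simp only [p]; push_cast; ring
    have hple : ∀ k, p k ≤ p (k + 1) := fun k => by rw [hpk]; exact le_self_add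
    have hsub : P.real B ≤ P.real (⋃ k : Fin (m + 1), manyEvents N (p k) (p (k + 1))) := by
      refine ENNReal.toReal_mono (measure_ne_top _ _) (measure_mono_ae ?_)
      filter_upwards [h.ae_add_le_of_notMem_manyEvents] with ω hω hωB
      by_contra hmany
      apply hωB
      have hk : ∀ k : ℕ, k ≤ m + 1 → ∀ i,
          X (p k) ω i + N .selfUpdate s ω ≤ X s ω i + N .selfUpdate (p k) ω := by
        intro k
        induction k with
        | zero => intro _ i; rw [hp0]
        | succ k ih =>
          intro hk i
          have h1 := ih (by omega) i
          have h2 := hω (p k) (p (k + 1)) (hple k)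
            (fun hmem => hmany (Set.mem_iUnion.2 ⟨⟨k, by omega⟩, hmem⟩)) i
          omega
      have := hk (m + 1) le_rfl
      rwa [hpm] at this
    refine hsub.trans ((measureReal_iUnion_fintype_le _).trans ?_)
    calc ∑ k : Fin (m + 1), P.real (manyEvents N (p k) (p (k + 1)))
        ≤ ∑ k : Fin (m + 1), c / (m + 1 : ℕ) ^ 2 := by
          refine Finset.sum_le_sum fun k _ => (h.poisson.measureReal_manyEvents_le hr (hple k)).trans
            (le_of_eq ?_)
          rw [hpk, NNReal.coe_add, NNReal.coe_div, NNReal.coe_sub hst, hc]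
          rw [add_sub_cancel_left, ← div_pow, mul_div_assoc]
          simp
      _ = c / (m + 1 : ℕ) := by
          rw [Finset.sum_const, Finset.card_univ, Fintype.card_fin, nsmul_eq_mul]
          have : ((m + 1 : ℕ) : ℝ) ≠ 0 := by positivity
          field_simp
  have hlim : Tendsto (fun m : ℕ => c / (m + 1 : ℕ)) atTop (𝓝 0) :=
    (tendsto_const_div_atTop_nhds_zero_nat c).comp (tendsto_add_atTop_nat 1)
  have h0 : P.real B = 0 := le_antisymm (ge_of_tendsto' hlim key) measureReal_nonneg
  exact (measureReal_eq_zero_iff).1 h0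

end IsVersionAgeProcess

/-! ### Minimal age over a set of nodes -/

/-- The smallest version age among the nodes in `S`. -/
noncomputable def minAge {n : ℕ} (S : Finset (Fin n)) (hS : S.Nonempty) (x : Fin n → ℕ) : ℝ :=
  (S.inf' hS x : ℕ)

lemma minAge_nonneg {n : ℕ} (S : Finset (Fin n)) (hS : S.Nonempty) (x : Fin n → ℕ) :
    0 ≤ minAge S hS x := Nat.cast_nonneg _

lemma minAge_le_add {n : ℕ} {S : Finset (Fin n)} (hS : S.Nonempty) {x y : Fin n → ℕ} {k : ℕ}
    (h : ∀ i, y i ≤ x i + k) : minAge S hS y ≤ minAge S hS x + k := by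
  obtain ⟨i, hi, hx⟩ := S.exists_mem_eq_inf' hS x
  rw [minAge, minAge, hx]
  exact_mod_cast (Finset.inf'_le _ hi).trans (h i)

lemma minAge_transition_le {n : ℕ} {S : Finset (Fin n)} (hS : S.Nonempty) (e : GossipEvent n)
    (x : Fin n → ℕ) : minAge S hS (e.transition x) ≤ minAge S hS x + 1 := by
  refine (minAge_le_add hS (x := x) (k := 1) fun i => ?_).trans (by simp)
  by_cases he : e = .selfUpdate
  · subst he; rfl
  · exact (e.transition_le he x i).trans (Nat.le_succ _)

lemma abs_minAge_transition_sub_le {n : ℕ} {S : Finset (Fin n)} (hS : S.Nonempty)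
    (e : GossipEvent n) (x : Fin n → ℕ) :
    |minAge S hS (e.transition x) - minAge S hS x| ≤ minAge S hS x + 1 := by
  have := minAge_transition_le hS e x
  have := minAge_nonneg S hS x
  have := minAge_nonneg S hS (e.transition x)
  rw [abs_le]
  constructor <;> linarith

/-! ### Short-time expansion of the mean minimal age -/

namespace IsVersionAgeProcess

variable {Ω : Type*} {mΩ : MeasurableSpace Ω} {n : ℕ} {rate : GossipEvent n → ℝ} {P : Measure Ω}
  {ℱ : Filtration ℝ≥0 mΩ} {N : GossipEvent n → ℝ≥0 → Ω → ℕ} {X : ℝ≥0 → Ω → Fin n → ℕ}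

lemma measurable_comp (h : IsVersionAgeProcess rate P ℱ N X) (φ : (Fin n → ℕ) → ℝ) (t : ℝ≥0) :
    Measurable[ℱ t] fun ω => φ (X t ω) :=
  (measurable_of_countable φ).comp (h.adapted t)

lemma aestronglyMeasurable_comp (h : IsVersionAgeProcess rate P ℱ N X) (φ : (Fin n → ℕ) → ℝ)
    (t : ℝ≥0) : AEStronglyMeasurable (fun ω => φ (X t ω)) P :=
  ((h.measurable_comp φ t).mono (ℱ.le t) le_rfl).aestronglyMeasurable

variable [IsProbabilityMeasure P]

lemma ae_le_add_eventCount (h : IsVersionAgeProcess rate P ℱ N X)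
    (hr : ∀ e, 0 ≤ rate e) {s t : ℝ≥0} (hst : s ≤ t) :
    ∀ᵐ ω ∂P, ∀ i, X t ω i ≤ X s ω i + eventCount N s t ω .selfUpdate := by
  filter_upwards [h.ae_add_le hr hst, h.poisson.mono] with ω h1 hm i
  have := h1 i
  have := hm .selfUpdate hst
  simp only [eventCount] at *
  omega

lemma integrable_age (h : IsVersionAgeProcess rate P ℱ N X) (hr : ∀ e, 0 ≤ rate e) (t : ℝ≥0)
    (i : Fin n) : Integrable (fun ω => (X t ω i : ℝ)) P := by
  refine ((h.integrable_init i).add (h.poisson.integrable_count (t := t) zero_le .selfUpdate)).mono'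
    (h.aestronglyMeasurable_comp (fun x => (x i : ℝ)) t) ?_
  filter_upwards [h.ae_le_add_eventCount hr (zero_le : 0 ≤ t)] with ω hω
  rw [Real.norm_of_nonneg (Nat.cast_nonneg _)]
  rw [Pi.add_apply]
  exact_mod_cast hω i

lemma integrable_minAge (h : IsVersionAgeProcess rate P ℱ N X) (hr : ∀ e, 0 ≤ rate e) (t : ℝ≥0)
    {S : Finset (Fin n)} (hS : S.Nonempty) : Integrable (fun ω => minAge S hS (X t ω)) P := by
  obtain ⟨i, hi⟩ := id hS
  refine (h.integrable_age hr t i).mono' (h.aestronglyMeasurable_comp (minAge S hS) t)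
    (.of_forall fun ω => ?_)
  rw [Real.norm_of_nonneg (minAge_nonneg _ _ _)]
  exact Nat.cast_le.2 (Finset.inf'_le _ hi)

lemma integrable_transition_sub (h : IsVersionAgeProcess rate P ℱ N X) (hr : ∀ e, 0 ≤ rate e)
    (t : ℝ≥0) {S : Finset (Fin n)} (hS : S.Nonempty) (e : GossipEvent n) :
    Integrable (fun ω => minAge S hS (e.transition (X t ω)) - minAge S hS (X t ω)) P :=
  ((h.integrable_minAge hr t hS).add (integrable_const 1)).mono'
    (h.aestronglyMeasurable_comp (fun x => minAge S hS (e.transition x) - minAge S hS x) t)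
    (.of_forall fun _ => abs_minAge_transition_sub_le hS e _)

lemma abs_integral_transition_sub_le (h : IsVersionAgeProcess rate P ℱ N X)
    (hr : ∀ e, 0 ≤ rate e) (t : ℝ≥0) {S : Finset (Fin n)} (hS : S.Nonempty) (e : GossipEvent n) :
    |∫ ω, (minAge S hS (e.transition (X t ω)) - minAge S hS (X t ω)) ∂P| ≤
      ∫ ω, minAge S hS (X t ω) ∂P + 1 := by
  refine (abs_integral_le_integral_abs).trans ?_
  calc _ ≤ ∫ ω, (minAge S hS (X t ω) + 1) ∂P :=
        integral_mono (h.integrable_transition_sub hr t hS e).abs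
          ((h.integrable_minAge hr t hS).add (integrable_const 1))
          fun _ => abs_minAge_transition_sub_le hS e _
    _ = _ := by
      rw [integral_add (h.integrable_minAge hr t hS) (integrable_const 1)]
      simp

lemma integral_minAge_le (h : IsVersionAgeProcess rate P ℱ N X) (hr : ∀ e, 0 ≤ rate e)
    {s t : ℝ≥0} (hst : s ≤ t) {S : Finset (Fin n)} (hS : S.Nonempty) :
    ∫ ω, minAge S hS (X t ω) ∂P ≤
      ∫ ω, minAge S hS (X s ω) ∂P + rate .selfUpdate * ((t : ℝ) - s) := by
  rw [← h.poisson.integral_count hst _ (hr _), ← integral_add (h.integrable_minAge hr s hS)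
    (h.poisson.integrable_count hst _)]
  refine integral_mono_ae (h.integrable_minAge hr t hS) ((h.integrable_minAge hr s hS).add
    (h.poisson.integrable_count hst _)) ?_
  filter_upwards [h.ae_le_add_eventCount hr hst] with ω hω
  exact minAge_le_add hS hω

/-- The count is not independent of `manyEvents`, so the bound does not factor. Instead the product
is dominated by the count minus the indicator of a lone self-update, whose mean `rate * h * (1 -
e^{-Λ h})`, with `h = t - s` and `Λ` the total rate, is of second order. -/
lemma integral_count_manyEvents_le (h : IsVersionAgeProcess rate P ℱ N X)
    (hr : ∀ e, 0 ≤ rate e) {s t : ℝ≥0} (hst : s ≤ t) :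
    ∫ ω, (eventCount N s t ω .selfUpdate : ℝ) * (manyEvents N s t).indicator 1 ω ∂P ≤
      rate .selfUpdate * (∑ e, rate e) * ((t : ℝ) - s) ^ 2 := by
  classical
  have hG := h.poisson.measurableSet_singleEvent s t .selfUpdate
  have hGi : Integrable ((singleEvent N s t .selfUpdate).indicator (1 : Ω → ℝ)) P :=
    (integrable_const (1 : ℝ)).indicator hG
  have hD := h.poisson.integrable_count hst .selfUpdate
  calc _ ≤ ∫ ω, ((eventCount N s t ω .selfUpdate : ℝ) -
        (singleEvent N s t .selfUpdate).indicator 1 ω) ∂P := by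
        refine integral_mono ?_ (hD.sub hGi) fun ω => ?_
        · refine (hD.indicator (h.poisson.measurableSet_manyEvents s t)).congr
            (.of_forall fun ω => ?_)
          by_cases hω : ω ∈ manyEvents N s t <;> simp [hω]
        · by_cases hω : ω ∈ singleEvent N s t .selfUpdate
          · have h1 : ω ∉ manyEvents N s t := fun hc => hc (Or.inr (Set.mem_iUnion.2 ⟨_, hω⟩))
            have := congrFun hω .selfUpdate
            rw [Pi.single_eq_same] at this
            simp [hω, h1, this]
          · by_cases hm : ω ∈ manyEvents N s t <;> simp [hω, hm]
    _ = rate .selfUpdate * ((t : ℝ) - s) *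
          (1 - Real.exp (-((∑ e, rate e) * ((t : ℝ) - s)))) := by
        rw [integral_sub hD hGi, h.poisson.integral_count hst _ (hr _), integral_indicator_one hG,
          h.poisson.measureReal_singleEvent hr hst]
        ring
    _ ≤ rate .selfUpdate * ((t : ℝ) - s) * ((∑ e, rate e) * ((t : ℝ) - s)) := by
        have h1 : 0 ≤ (t : ℝ) - s := sub_nonneg.2 (by exact_mod_cast hst)
        have h2 := Real.one_sub_le_exp_neg ((∑ e, rate e) * ((t : ℝ) - s))
        exact mul_le_mul_of_nonneg_left (by linarith) (mul_nonneg (hr _) h1)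
    _ = _ := by ring

/-- With at most one event the sum is exactly the change of the minimum, so the remainder lives on
`manyEvents`. There the minimum may fall to 0 or rise by the number of self-updates. -/
lemma ae_abs_remainder_le (h : IsVersionAgeProcess rate P ℱ N X) (hr : ∀ e, 0 ≤ rate e)
    {s t : ℝ≥0} (hst : s ≤ t) {S : Finset (Fin n)} (hS : S.Nonempty) :
    ∀ᵐ ω ∂P, |minAge S hS (X t ω) - minAge S hS (X s ω) -
      ∑ e : GossipEvent n, (minAge S hS (e.transition (X s ω)) - minAge S hS (X s ω)) *
        (singleEvent N s t e).indicator 1 ω| ≤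
      (minAge S hS (X s ω) + eventCount N s t ω .selfUpdate) *
        (manyEvents N s t).indicator 1 ω := by
  classical
  filter_upwards [h.ae_le_add_eventCount hr hst, h.ae_eq_transition] with ω h1 h2
  by_cases hm : ω ∈ manyEvents N s t
  · have h3 : ∀ e, ω ∉ singleEvent N s t e := fun e he =>
      hm (Or.inr (Set.mem_iUnion.2 ⟨e, he⟩))
    simp only [h3, not_false_eq_true, Set.indicator_of_notMem, mul_zero, Finset.sum_const_zero,
      sub_zero, hm, Set.indicator_of_mem, Pi.one_apply, mul_one]
    have := minAge_le_add hS h1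
    have := minAge_nonneg S hS (X s ω)
    have := minAge_nonneg S hS (X t ω)
    rw [abs_le]
    constructor <;> linarith
  · rw [Set.indicator_of_notMem hm, mul_zero]
    rw [manyEvents, Set.notMem_compl_iff, Set.mem_union, Set.mem_iUnion] at hm
    rcases hm with hω | ⟨e, hω⟩
    · have h3 : ∀ e, ω ∉ singleEvent N s t e := fun e he =>
        Set.disjoint_left.1 (disjoint_noEvents_singleEvent N s t e) hω he
      simp [h3, (h2 s t hst).1 hω]
    · rw [Finset.sum_eq_single e]
      · simp [hω, (h2 s t hst).2 e hω]
      · intro e' _ he'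
        have : ω ∉ singleEvent N s t e' := fun hc =>
          Set.disjoint_left.1 (disjoint_singleEvent N s t he') hc hω
        simp [this]
      · simp

/-- The generator of the version age process, applied to the minimal age on `S`. -/
lemma abs_integral_minAge_sub_le (h : IsVersionAgeProcess rate P ℱ N X) (hr : ∀ e, 0 ≤ rate e)
    {s t : ℝ≥0} (hst : s ≤ t) {S : Finset (Fin n)} (hS : S.Nonempty) :
    |∫ ω, minAge S hS (X t ω) ∂P - ∫ ω, minAge S hS (X s ω) ∂P - ((t : ℝ) - s) *
      ∑ e, rate e * ∫ ω, (minAge S hS (e.transition (X s ω)) - minAge S hS (X s ω)) ∂P| ≤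
      2 * (∑ e, rate e) ^ 2 * (∫ ω, minAge S hS (X s ω) ∂P + 1) * ((t : ℝ) - s) ^ 2 := by
  classical
  set Λ := ∑ e, rate e with hΛ
  set m := ∫ ω, minAge S hS (X s ω) ∂P with hm
  have hh : 0 ≤ (t : ℝ) - s := sub_nonneg.2 (by exact_mod_cast hst)
  have hΛ0 : 0 ≤ Λ := Finset.sum_nonneg fun e _ => hr e
  have hm0 : 0 ≤ m := integral_nonneg fun ω => minAge_nonneg _ _ _
  have hind : ∀ {Y : Ω → ℝ} {A : Set Ω}, Integrable Y P → MeasurableSet A →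
      Integrable (fun ω => Y ω * A.indicator 1 ω) P := by
    intro Y A hY hA
    refine (hY.indicator hA).congr (.of_forall fun ω => ?_)
    by_cases hω : ω ∈ A <;> simp [hω]
  have hZi := fun e => hind (h.integrable_transition_sub hr s hS e)
    (h.poisson.measurableSet_singleEvent s t e)
  -- The jump that `e` would cause depends only on the state at time `s`, hence is independent of
  -- the counts over `(s, t]`.
  have hZ : ∀ e : GossipEvent n,
      ∫ ω, (minAge S hS (e.transition (X s ω)) - minAge S hS (X s ω)) *
        (singleEvent N s t e).indicator 1 ω ∂P =
      (∫ ω, (minAge S hS (e.transition (X s ω)) - minAge S hS (X s ω)) ∂P) *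
        (rate e * ((t : ℝ) - s) * Real.exp (-(Λ * ((t : ℝ) - s)))) := by
    intro e
    rw [hΛ, ← h.poisson.measureReal_singleEvent hr hst e]
    exact h.poisson.integral_mul_indicator hst
      (h.measurable_comp (fun x => minAge S hS (e.transition x) - minAge S hS x) s)
      (measurableSet_singleton _)
  have hBm := h.poisson.measurableSet_manyEvents s t
  have hBY : ∫ ω, minAge S hS (X s ω) * (manyEvents N s t).indicator 1 ω ∂P ≤
      m * (Λ * ((t : ℝ) - s)) ^ 2 := by
    have hA : manyEvents N s t = eventCount N s t ⁻¹' ({0} ∪ ⋃ e, {Pi.single e 1})ᶜ := by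
      simp only [manyEvents, noEvents, singleEvent, Set.preimage_compl, Set.preimage_union,
        Set.preimage_iUnion]
    have hAm : MeasurableSet (({0} ∪ ⋃ e, {Pi.single e 1})ᶜ : Set (GossipEvent n → ℕ)) :=
      (Set.to_countable _).measurableSet
    have := h.poisson.integral_mul_indicator hst (h.measurable_comp (minAge S hS) s) hAm
    rw [← hA] at this
    rw [this]
    exact mul_le_mul_of_nonneg_left (h.poisson.measureReal_manyEvents_le hr hst) hm0
  have hrem : |∫ ω, (minAge S hS (X t ω) - minAge S hS (X s ω) -
      ∑ e : GossipEvent n, (minAge S hS (e.transition (X s ω)) - minAge S hS (X s ω)) *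
        (singleEvent N s t e).indicator 1 ω) ∂P| ≤
      m * (Λ * ((t : ℝ) - s)) ^ 2 + rate .selfUpdate * Λ * ((t : ℝ) - s) ^ 2 := by
    refine abs_integral_le_integral_abs.trans ?_
    have hi1 := hind (h.integrable_minAge hr s hS) hBm
    have hi2 := hind (h.poisson.integrable_count hst .selfUpdate) hBm
    refine (integral_mono_ae ?_ ?_ (h.ae_abs_remainder_le hr hst hS)).trans ?_
    · exact (((h.integrable_minAge hr t hS).sub (h.integrable_minAge hr s hS)).sub
        (integrable_finsetSum _ fun e _ => hZi e)).abs
    · simp_rw [add_mul]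
      exact hi1.add hi2
    · simp_rw [add_mul]
      rw [integral_add hi1 hi2]
      exact add_le_add hBY (h.integral_count_manyEvents_le hr hst)
  rw [integral_sub (f := fun ω => minAge S hS (X t ω) - minAge S hS (X s ω))
    ((h.integrable_minAge hr t hS).sub (h.integrable_minAge hr s hS))
    (integrable_finsetSum _ fun e _ => hZi e), integral_sub (h.integrable_minAge hr t hS)
    (h.integrable_minAge hr s hS), integral_finsetSum _ fun e _ => hZi e] at hrem
  simp_rw [hZ] at hrem
  have hself : rate .selfUpdate ≤ Λ := Finset.single_le_sum (fun e _ => hr e) (Finset.mem_univ _)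
  -- Replacing `exp (-(Λ * (t - s)))` by 1 costs a factor at most `Λ * (t - s)`, again a
  -- second-order error.
  have hdiff : |((t : ℝ) - s) *
        ∑ e, rate e * ∫ ω, (minAge S hS (e.transition (X s ω)) - minAge S hS (X s ω)) ∂P -
      ∑ e : GossipEvent n, (∫ ω, (minAge S hS (e.transition (X s ω)) - minAge S hS (X s ω)) ∂P) *
        (rate e * ((t : ℝ) - s) * Real.exp (-(Λ * ((t : ℝ) - s))))| ≤
      (m + 1) * (Λ * ((t : ℝ) - s)) ^ 2 := by
    have h1 := Real.one_sub_le_exp_neg (Λ * ((t : ℝ) - s))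
    have h2 : Real.exp (-(Λ * ((t : ℝ) - s))) ≤ 1 := by
      rw [Real.exp_le_one_iff]
      have := mul_nonneg hΛ0 hh
      linarith
    rw [Finset.mul_sum, ← Finset.sum_sub_distrib]
    calc _ ≤ ∑ e : GossipEvent n, rate e * (((t : ℝ) - s) * (m + 1) * (Λ * ((t : ℝ) - s))) := by
          refine (Finset.abs_sum_le_sum_abs _ _).trans (Finset.sum_le_sum fun e _ => ?_)
          have h3 := h.abs_integral_transition_sub_le hr s hS e
          set z := ∫ ω, (minAge S hS (e.transition (X s ω)) - minAge S hS (X s ω)) ∂P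
          have h4 : ((t : ℝ) - s) * (rate e * z) -
              z * (rate e * ((t : ℝ) - s) * Real.exp (-(Λ * ((t : ℝ) - s)))) =
              rate e * (((t : ℝ) - s) * z * (1 - Real.exp (-(Λ * ((t : ℝ) - s))))) := by ring
          rw [h4, abs_mul, abs_mul, abs_mul, abs_of_nonneg (hr e), abs_of_nonneg hh,
            abs_of_nonneg (sub_nonneg.2 h2)]
          refine mul_le_mul_of_nonneg_left ?_ (hr e)
          refine mul_le_mul (mul_le_mul_of_nonneg_left h3 hh) (by linarith) (by linarith)
            (by positivity)
      _ = _ := by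
          rw [← Finset.sum_mul, ← hΛ]
          ring
  rw [abs_le] at hrem hdiff ⊢
  have h5 : rate .selfUpdate * Λ * ((t : ℝ) - s) ^ 2 ≤ Λ * Λ * ((t : ℝ) - s) ^ 2 := by
    gcongr
  constructor <;> nlinarith [hrem.1, hrem.2, hdiff.1, hdiff.2]

end IsVersionAgeProcess

/-! ### The generator on minimal ages -/

section Generator

variable {n : ℕ}

lemma minAge_eq {S S' : Finset (Fin n)} (hS : S.Nonempty) (hS' : S'.Nonempty) {x y : Fin n → ℕ}
    (h : ∀ k, (∀ l ∈ S, k ≤ x l) ↔ ∀ l ∈ S', k ≤ y l) : minAge S hS x = minAge S' hS' y := by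
  rw [minAge, minAge, Nat.cast_inj]
  exact eq_of_forall_le_iff fun k => by rw [Finset.le_inf'_iff, Finset.le_inf'_iff, h k]

/-- The change of the minimal age on `S` when node `i` outside `S` shares its version with
node `j` in `S`. -/
noncomputable def minAgeGain (S : Finset (Fin n)) (hS : S.Nonempty) (x : Fin n → ℕ)
    (i j : Fin n) : ℝ :=
  if i ∉ S ∧ j ∈ S then minAge (insert i S) (Finset.insert_nonempty i S) x - minAge S hS x else 0

lemma minAge_selfUpdate {S : Finset (Fin n)} (hS : S.Nonempty) (x : Fin n → ℕ) :
    minAge S hS (GossipEvent.selfUpdate.transition x) - minAge S hS x = 1 := by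
  obtain ⟨i, hi, hx⟩ := S.exists_mem_eq_inf' hS x
  have : S.inf' hS (GossipEvent.selfUpdate.transition x) = S.inf' hS x + 1 := by
    refine le_antisymm ?_ ((Finset.le_inf'_iff _ _).2 fun l hl => ?_)
    · rw [hx]; exact Finset.inf'_le _ hi
    · exact Nat.succ_le_succ (Finset.inf'_le _ hl)
  rw [minAge, minAge, this]
  push_cast
  ring

lemma minAge_sub_of_reset {S : Finset (Fin n)} (hS : S.Nonempty) (x : Fin n → ℕ) (j : Fin n) :
    minAge S hS (fun l => if l = j then 0 else x l) - minAge S hS x =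
      if j ∈ S then - minAge S hS x else 0 := by
  split_ifs with hj
  · have : minAge S hS (fun l => if l = j then 0 else x l) = 0 := by
      rw [minAge, Nat.cast_eq_zero, ← Nat.le_zero]
      exact (Finset.inf'_le _ hj).trans (by simp)
    rw [this, zero_sub]
  · rw [sub_eq_zero]
    refine minAge_eq hS hS fun k => forall₂_congr fun l hl => ?_
    have : l ≠ j := fun h => hj (h ▸ hl)
    simp [this]

/-- If `j ∈ S`, the minimum over `S` afterwards is the minimum over `insert i S` before; this is new
only when `i ∉ S`. -/
lemma minAge_gossip {S : Finset (Fin n)} (hS : S.Nonempty) (x : Fin n → ℕ) {i j : Fin n}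
    (h : i ≠ j) : minAge S hS ((GossipEvent.gossip i j h).transition x) - minAge S hS x =
      minAgeGain S hS x i j := by
  by_cases hj : j ∈ S
  · have h1 : minAge S hS ((GossipEvent.gossip i j h).transition x) =
        minAge (insert i S) (Finset.insert_nonempty i S) x := by
      refine minAge_eq _ _ fun k => ?_
      simp only [GossipEvent.transition, Finset.mem_insert]
      constructor
      · rintro H l (rfl | hl)
        · have := H j hj
          simp only [if_true] at this
          exact this.trans (min_le_right _ _)
        · have := H l hl
          split_ifs at this with hlj
          · subst hlj; exact this.trans (min_le_left _ _)
          · exact this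
      · intro H l hl
        split_ifs with hlj
        · exact le_min (H j (.inr hj)) (H i (.inl rfl))
        · exact H l (.inr hl)
    rw [h1, minAgeGain]
    by_cases hi : i ∈ S
    · simp [hi, Finset.insert_eq_of_mem hi]
    · simp [hi, hj]
  · rw [minAgeGain, if_neg fun hc => hj hc.2, sub_eq_zero]
    refine minAge_eq hS hS fun k => forall₂_congr fun l hl => ?_
    have : l ≠ j := fun h => hj (h ▸ hl)
    simp [GossipEvent.transition, this]

/-- At most one of the two gains is nonzero, because it needs exactly one endpoint in `S`. A contact
thus acts on minima like gossip in both directions, which is why its rate simply adds to the gossip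
rate. -/
lemma minAge_contact {S : Finset (Fin n)} (hS : S.Nonempty) (x : Fin n → ℕ) {i j : Fin n}
    (h : i < j) : minAge S hS ((GossipEvent.contact i j h).transition x) - minAge S hS x =
      minAgeGain S hS x i j + minAgeGain S hS x j i := by
  have hin : (i ∈ S ∨ j ∈ S) → minAge S hS ((GossipEvent.contact i j h).transition x) =
      minAge (insert i (insert j S)) (Finset.insert_nonempty _ _) x := by
    intro hij
    refine minAge_eq _ _ fun k => ?_
    simp only [GossipEvent.transition, Finset.mem_insert]
    constructor
    · intro H l hl
      have hk : k ≤ min (x i) (x j) := by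
        rcases hij with hi | hj
        · simpa using H i hi
        · simpa using H j hj
      rcases hl with rfl | rfl | hl
      · exact hk.trans (min_le_left _ _)
      · exact hk.trans (min_le_right _ _)
      · have := H l hl
        split_ifs at this with hlj
        · rcases hlj with rfl | rfl
          · exact hk.trans (min_le_left _ _)
          · exact hk.trans (min_le_right _ _)
        · exact this
    · intro H l hl
      split_ifs with hlj
      · exact le_min (H i (.inl rfl)) (H j (.inr (.inl rfl)))
      · exact H l (.inr (.inr hl))
  by_cases hi : i ∈ S <;> by_cases hj : j ∈ S
  · rw [hin (.inl hi)]
    simp [minAgeGain, hi, hj]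
  · rw [hin (.inl hi)]
    simp [minAgeGain, hi, hj]
  · rw [hin (.inr hj)]
    simp [minAgeGain, hi, hj]
  · simp only [minAgeGain, hi, hj, not_false_eq_true, and_false, if_false, add_zero, sub_eq_zero]
    refine minAge_eq hS hS fun k => forall₂_congr fun l hl => ?_
    have h1 : l ≠ i := fun h => hi (h ▸ hl)
    have h2 : l ≠ j := fun h => hj (h ▸ hl)
    simp [GossipEvent.transition, h1, h2]

/-- The gain does not depend on which of the `S.card` members receives the news. -/
lemma sum_minAgeGain {S : Finset (Fin n)} (hS : S.Nonempty) (x : Fin n → ℕ) :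
    ∑ i, ∑ j, minAgeGain S hS x i j = S.card *
      ∑ i ∈ Sᶜ, (minAge (insert i S) (Finset.insert_nonempty i S) x - minAge S hS x) := by
  rw [Finset.mul_sum, ← Finset.sum_subset (Finset.subset_univ Sᶜ)]
  · refine Finset.sum_congr rfl fun i hi => ?_
    simp [minAgeGain, Finset.mem_compl.1 hi, mul_sub]
  · intro i _ hi
    refine Finset.sum_eq_zero fun j _ => ?_
    have : i ∈ S := by simpa using hi
    simp [minAgeGain, this]

lemma sum_ne_eq_sum_sum (H : Fin n → Fin n → ℝ) (hH : ∀ i, H i i = 0) :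
    ∑ p : {p : Fin n × Fin n // p.1 ≠ p.2}, H p.1.1 p.1.2 = ∑ i, ∑ j, H i j := by
  rw [← Finset.sum_subtype (Finset.univ.filter fun p : Fin n × Fin n => p.1 ≠ p.2) (by simp)
    fun p => H p.1 p.2, Finset.sum_filter, Fintype.sum_prod_type]
  refine Finset.sum_congr rfl fun i _ => Finset.sum_congr rfl fun j _ => ?_
  by_cases h : i = j
  · subst h; simp [hH]
  · simp [h]

lemma sum_lt_eq_sum_sum (H : Fin n → Fin n → ℝ) (hH : ∀ i, H i i = 0) :
    ∑ p : {p : Fin n × Fin n // p.1 < p.2}, (H p.1.1 p.1.2 + H p.1.2 p.1.1) =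
      ∑ i, ∑ j, H i j := by
  rw [← Finset.sum_subtype (Finset.univ.filter fun p : Fin n × Fin n => p.1 < p.2) (by simp)
    fun p => H p.1 p.2 + H p.2 p.1, Finset.sum_add_distrib, Finset.sum_filter, Finset.sum_filter,
    Fintype.sum_prod_type, Fintype.sum_prod_type_right, ← Finset.sum_add_distrib]
  refine Finset.sum_congr rfl fun i _ => ?_
  rw [← Finset.sum_add_distrib]
  refine Finset.sum_congr rfl fun j _ => ?_
  rcases lt_trichotomy i j with h | h | h
  · simp [h, h.not_gt]
  · subst h; simp [hH]
  · simp [h, h.not_gt]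

/-- The rate at which a node gossips to each other node. -/
noncomputable def gossipRate (T : GossipTopology) (n : ℕ) (l : ℝ) : ℝ :=
  match T with
  | .disconnected => 0
  | .fullyConnected => l / ((n : ℝ) - 1)

lemma symmetricRate_gossip (T : GossipTopology) (le l fn : ℝ) {i j : Fin n} (h : i ≠ j) :
    symmetricRate (T.graph n) le l fn (.gossip i j h) = gossipRate T n l := by
  cases T <;> simp [symmetricRate, GossipTopology.graph, gossipRate, h]

lemma gossipRate_nonneg (T : GossipTopology) (hn : 1 ≤ n) {l : ℝ} (hl : 0 ≤ l) :
    0 ≤ gossipRate T n l := by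
  cases T
  · exact le_rfl
  · exact div_nonneg hl (sub_nonneg.2 (by exact_mod_cast hn))

lemma symmetricRate_nonneg (T : GossipTopology) (hn : 1 ≤ n) {le l fn : ℝ} (hle : 0 ≤ le)
    (hl : 0 ≤ l) (hfn : 0 ≤ fn) (e : GossipEvent n) :
    0 ≤ symmetricRate (T.graph n) le l fn e := by
  cases e with
  | selfUpdate => exact hle
  | push j => exact div_nonneg hl (Nat.cast_nonneg n)
  | gossip i j h => rw [symmetricRate_gossip]; exact gossipRate_nonneg T hn hl
  | sourceContact j => exact div_nonneg hl hfn
  | contact i j h => exact div_nonneg hl hfn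

/-- The generator of the version age process with symmetric rates, applied to the minimal age. -/
lemma sum_symmetricRate_mul (T : GossipTopology) (le l fn : ℝ) {S : Finset (Fin n)}
    (hS : S.Nonempty) (x : Fin n → ℕ) :
    ∑ e, symmetricRate (T.graph n) le l fn e *
      (minAge S hS (e.transition x) - minAge S hS x) =
    le - S.card * (l / n + l / fn) * minAge S hS x + S.card * (gossipRate T n l + l / fn) *
      ∑ i ∈ Sᶜ, (minAge (insert i S) (Finset.insert_nonempty i S) x - minAge S hS x) := by
  have hreset : ∀ c : ℝ, ∑ j, c * (minAge S hS (fun l => if l = j then 0 else x l) -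
      minAge S hS x) = - (S.card * c * minAge S hS x) := by
    intro c
    simp_rw [minAge_sub_of_reset, ← Finset.mul_sum]
    simp
    ring
  have hgain : ∀ i, minAgeGain S hS x i i = 0 := fun i => if_neg fun h => h.1 h.2
  rw [sum_gossipEvent, minAge_selfUpdate]
  simp_rw [symmetricRate_gossip, minAge_gossip, minAge_contact]
  simp only [symmetricRate, GossipEvent.transition, hreset]
  rw [← Finset.mul_sum, ← Finset.mul_sum, sum_ne_eq_sum_sum _ hgain, sum_lt_eq_sum_sum _ hgain,
    sum_minAgeGain]
  ring

end Generator

/-! ### Asymptotics of a scalar linear differential equation -/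

section LinearODE

/-- Once `g ≤ M` with `M / a < b`, Grönwall's inequality with the negative constant `-a` bounds `f`
by a function tending to `M / a`. Right derivatives and continuity suffice. -/
lemma eventually_lt_of_hasDerivWithinAt_linear {f g : ℝ → ℝ} {a L : ℝ} (ha : 0 < a)
    (hf : ContinuousOn f (Set.Ici 0))
    (hf' : ∀ x, 0 ≤ x → HasDerivWithinAt f (g x - a * f x) (Set.Ici x) x)
    (hg : Tendsto g atTop (𝓝 L)) {b : ℝ} (hb : L / a < b) : ∀ᶠ x in atTop, f x < b := by
  obtain ⟨M, hLM, hMb⟩ : ∃ M, L < M ∧ M / a < b := by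
    obtain ⟨c, h1, h2⟩ := exists_between hb
    exact ⟨c * a, (div_lt_iff₀ ha).1 h1, by rwa [mul_div_cancel_right₀ _ ha.ne']⟩
  obtain ⟨T, hT0, hT⟩ : ∃ T, 0 ≤ T ∧ ∀ x, T ≤ x → g x ≤ M := by
    obtain ⟨T, hT⟩ := eventually_atTop.1 (hg.eventually_le_const hLM)
    exact ⟨max T 0, le_max_right _ _, fun x hx => hT x ((le_max_left _ _).trans hx)⟩
  have hbound : ∀ x, T ≤ x → f x ≤ gronwallBound (f T) (-a) M (x - T) := by
    intro x hx
    refine le_gronwallBound_of_liminf_deriv_right_le (f' := fun x => g x - a * f x)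
      (hf.mono fun y hy => hT0.trans hy.1) (fun y hy r hr => ?_) le_rfl (fun y hy => ?_) x
      ⟨hx, le_rfl⟩
    · simpa [slope_def_field, div_eq_inv_mul] using (hf' y (hT0.trans hy.1)).liminf_right_slope_le hr
    · have := hT y hy.1
      linarith
  have hexp : Tendsto (fun x => Real.exp (-a * (x - T))) atTop (𝓝 0) := by
    refine Real.tendsto_exp_atBot.comp ?_
    exact (tendsto_atTop_add_const_right _ (-T) tendsto_id).const_mul_atTop_of_neg (by linarith)
  have hlim : Tendsto (fun x => gronwallBound (f T) (-a) M (x - T)) atTop (𝓝 (M / a)) := by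
    simp only [gronwallBound_of_K_ne_0 (neg_ne_zero.2 ha.ne')]
    convert (hexp.const_mul (f T)).add ((hexp.sub_const 1).const_mul (M / -a)) using 2
    rw [div_neg]
    ring
  filter_upwards [hlim.eventually_lt_const hMb, eventually_ge_atTop T] with x h1 h2
  exact (hbound x h2).trans_lt h1

/-- The solutions of `f' = g - a * f` with `a > 0` tend to `L / a` if `g` tends to `L`. -/
lemma tendsto_of_hasDerivWithinAt_linear {f g : ℝ → ℝ} {a L : ℝ} (ha : 0 < a)
    (hf : ContinuousOn f (Set.Ici 0))
    (hf' : ∀ x, 0 ≤ x → HasDerivWithinAt f (g x - a * f x) (Set.Ici x) x)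
    (hg : Tendsto g atTop (𝓝 L)) : Tendsto f atTop (𝓝 (L / a)) := by
  refine tendsto_order.2 ⟨fun b hb => ?_, fun b hb =>
    eventually_lt_of_hasDerivWithinAt_linear ha hf hf' hg hb⟩
  have := eventually_lt_of_hasDerivWithinAt_linear (f := fun x => - f x) (g := fun x => - g x)
    (b := -b) ha hf.neg (fun x hx => ?_) hg.neg (by rw [neg_div]; exact neg_lt_neg hb)
  · filter_upwards [this] with x hx using neg_lt_neg_iff.1 hx
  · exact (hf' x hx).neg.congr_deriv (by ring)

/-- A function whose increments over `(s, t]` are `(t - s) * D s` up to an error of second order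
solves `f' = D` from the right. -/
lemma hasDerivWithinAt_of_abs_sub_le {V D : ℝ≥0 → ℝ} {C : ℝ≥0 → ℝ}
    (h : ∀ s t, s ≤ t → |V t - V s - ((t : ℝ) - s) * D s| ≤ C s * ((t : ℝ) - s) ^ 2)
    {x : ℝ} (hx : 0 ≤ x) :
    HasDerivWithinAt (fun y => V y.toNNReal) (D x.toNNReal) (Set.Ici x) x := by
  rw [hasDerivWithinAt_iff_isLittleO]
  have h1 : (fun y => V y.toNNReal - V x.toNNReal - (y - x) • D x.toNNReal)
      =O[𝓝[Set.Ici x] x] fun y => (y - x) ^ 2 := by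
    refine IsBigO.of_bound (C x.toNNReal) ?_
    filter_upwards [self_mem_nhdsWithin] with y hy
    have h2 := h x.toNNReal y.toNNReal (Real.toNNReal_le_toNNReal hy)
    rw [Real.coe_toNNReal _ hx, Real.coe_toNNReal _ (hx.trans hy)] at h2
    rw [Real.norm_eq_abs, Real.norm_of_nonneg (sq_nonneg _)]
    exact h2
  refine h1.trans_isLittleO ?_
  have h3 : Tendsto (fun y => y - x) (𝓝[Set.Ici x] x) (𝓝 0) := by
    have : Tendsto (fun y => y - x) (𝓝 x) (𝓝 (x - x)) := (continuous_sub_right x).tendsto x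
    rw [sub_self] at this
    exact this.mono_left nhdsWithin_le_nhds
  simpa [pow_two] using ((isLittleO_one_iff ℝ).2 h3).mul_isBigO
    (isBigO_refl (fun y => y - x) (𝓝[Set.Ici x] x))

lemma continuous_of_abs_sub_le {V : ℝ≥0 → ℝ}
    (h : ∀ T, ∃ K : ℝ, ∀ s t, s ≤ t → t ≤ T → |V t - V s| ≤ K * ((t : ℝ) - s)) :
    Continuous V := by
  refine continuous_iff_continuousAt.2 fun t => ?_
  obtain ⟨K, hK⟩ := h (t + 1)
  have hL : LipschitzOnWith K.toNNReal V (Set.Iic (t + 1)) := by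
    refine LipschitzOnWith.of_dist_le_mul fun x hx y hy => ?_
    wlog hxy : x ≤ y generalizing x y
    · rw [dist_comm, dist_comm x]
      exact this y hy x hx (le_of_not_ge hxy)
    rw [dist_comm, dist_comm x, Real.dist_eq, NNReal.dist_eq]
    have hyx : (0 : ℝ) ≤ y - x := sub_nonneg.2 (by exact_mod_cast hxy)
    rw [abs_of_nonneg hyx]
    exact (hK x y hxy hy).trans (mul_le_mul_of_nonneg_right (Real.le_coe_toNNReal K) hyx)
  exact hL.continuousOn.continuousAt (Iic_mem_nhds (lt_add_one t))

end LinearODE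

/-! ### Convergence of the mean minimal ages -/

section SteadyState

/-- The steady-state mean of the minimal age of `n - m` nodes, where `a` is the total rate at which
the source informs a node and `b` the total rate at which a node informs another one. -/
noncomputable def steadyMinAge (le a b : ℝ) (n : ℕ) : ℕ → ℝ
  | 0 => le / (n * a)
  | m + 1 => (le + ((n : ℝ) - (m + 1)) * b * (m + 1) * steadyMinAge le a b n m) /
      (((n : ℝ) - (m + 1)) * (a + (m + 1) * b))

namespace IsVersionAgeProcess

variable {Ω : Type*} {mΩ : MeasurableSpace Ω} {n : ℕ} {rate : GossipEvent n → ℝ} {P : Measure Ω}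
  {ℱ : Filtration ℝ≥0 mΩ} {N : GossipEvent n → ℝ≥0 → Ω → ℕ} {X : ℝ≥0 → Ω → Fin n → ℕ}
  [IsProbabilityMeasure P]

/-- The expansion yields only right derivatives, while Grönwall also needs continuity. On `[0, T]`
the mean is bounded, so the expansion gives a Lipschitz estimate. -/
lemma continuous_integral_minAge (h : IsVersionAgeProcess rate P ℱ N X)
    (hr : ∀ e, 0 ≤ rate e) {S : Finset (Fin n)} (hS : S.Nonempty) :
    Continuous fun t => ∫ ω, minAge S hS (X t ω) ∂P := by
  refine continuous_of_abs_sub_le fun T => ?_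
  set Λ := ∑ e, rate e with hΛ
  have hΛ0 : 0 ≤ Λ := Finset.sum_nonneg fun e _ => hr e
  set M := ∫ ω, minAge S hS (X 0 ω) ∂P + rate .selfUpdate * T + 1 with hM
  refine ⟨Λ * M + 2 * Λ ^ 2 * M * T, fun s t hst htT => ?_⟩
  have hh : 0 ≤ (t : ℝ) - s := sub_nonneg.2 (by exact_mod_cast hst)
  have hhT : (t : ℝ) - s ≤ T := by
    have h1 : (t : ℝ) ≤ T := by exact_mod_cast htT
    have h2 : (0 : ℝ) ≤ s := s.2
    linarith
  have hV : ∫ ω, minAge S hS (X s ω) ∂P + 1 ≤ M := by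
    have h1 := h.integral_minAge_le hr (zero_le : 0 ≤ s) hS
    have h2 : rate .selfUpdate * ((s : ℝ) - (0 : ℝ≥0)) ≤ rate .selfUpdate * T := by
      refine mul_le_mul_of_nonneg_left ?_ (hr _)
      have : (s : ℝ) ≤ T := by exact_mod_cast hst.trans htT
      simpa using this
    linarith
  have hV0 : 0 ≤ ∫ ω, minAge S hS (X s ω) ∂P := integral_nonneg fun ω => minAge_nonneg _ _ _
  have hM0 : 0 ≤ M := by linarith
  have h1 := h.abs_integral_minAge_sub_le hr hst hS
  have h2 : |∑ e, rate e * ∫ ω, (minAge S hS (e.transition (X s ω)) - minAge S hS (X s ω)) ∂P| ≤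
      Λ * M := by
    rw [hΛ, Finset.sum_mul]
    refine (Finset.abs_sum_le_sum_abs _ _).trans (Finset.sum_le_sum fun e _ => ?_)
    rw [abs_mul, abs_of_nonneg (hr e)]
    exact mul_le_mul_of_nonneg_left ((h.abs_integral_transition_sub_le hr s hS e).trans hV) (hr e)
  set G := ∑ e, rate e * ∫ ω, (minAge S hS (e.transition (X s ω)) - minAge S hS (X s ω)) ∂P
  have h3 : |((t : ℝ) - s) * G| ≤ ((t : ℝ) - s) * (Λ * M) := by
    rw [abs_mul, abs_of_nonneg hh]
    exact mul_le_mul_of_nonneg_left h2 hh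
  have h4 : 2 * Λ ^ 2 * (∫ ω, minAge S hS (X s ω) ∂P + 1) * ((t : ℝ) - s) ^ 2 ≤
      2 * Λ ^ 2 * M * (T * ((t : ℝ) - s)) := by
    rw [pow_two ((t : ℝ) - s)]
    gcongr
  rw [abs_le] at h1 h3 ⊢
  constructor <;> nlinarith [h1.1, h1.2, h3.1, h3.2]

lemma tendsto_integral_minAge {T : GossipTopology} {le l fn : ℝ} (hn : 1 ≤ n) (hle : 0 ≤ le)
    (hl : 0 < l) (hfn : 0 ≤ fn)
    (h : IsVersionAgeProcess (symmetricRate (T.graph n) le l fn) P ℱ N X) (m : ℕ)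
    {S : Finset (Fin n)} (hS : S.Nonempty) (hm : S.card + m = n) :
    Tendsto (fun t => ∫ ω, minAge S hS (X t ω) ∂P) atTop
      (𝓝 (steadyMinAge le (l / n + l / fn) (gossipRate T n l + l / fn) n m)) := by
  set a := l / n + l / fn with ha
  set b := gossipRate T n l + l / fn with hb
  have hr := symmetricRate_nonneg T hn hle hl.le hfn
  have ha0 : 0 < a := add_pos_of_pos_of_nonneg (div_pos hl (by exact_mod_cast hn))
    (div_nonneg hl.le hfn)
  have hb0 : 0 ≤ b := add_nonneg (gossipRate_nonneg T hn hl.le) (div_nonneg hl.le hfn)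
  have hcard : (0 : ℝ) < S.card := by exact_mod_cast hS.card_pos
  have hcompl : (Sᶜ.card : ℝ) = m := by
    have := Finset.card_add_card_compl S
    rw [Fintype.card_fin] at this
    exact_mod_cast (by omega : Sᶜ.card = m)
  -- The forcing term involves only sets with one more node, so it converges by induction on `m`; it
  -- is constant when `m = 0`.
  let g : ℝ≥0 → ℝ := fun t => le + S.card * b *
    ∑ i ∈ Sᶜ, ∫ ω, minAge (insert i S) (Finset.insert_nonempty i S) (X t ω) ∂P
  have hgen : ∀ t, ∑ e, symmetricRate (T.graph n) le l fn e *
      ∫ ω, (minAge S hS (e.transition (X t ω)) - minAge S hS (X t ω)) ∂P =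
      g t - S.card * (a + m * b) * ∫ ω, minAge S hS (X t ω) ∂P := by
    intro t
    have hS' := fun i => h.integrable_minAge hr t (Finset.insert_nonempty i S)
    have hSi := h.integrable_minAge hr t hS
    have hdiff : ∀ i, Integrable (fun ω => minAge (insert i S) (Finset.insert_nonempty i S)
        (X t ω) - minAge S hS (X t ω)) P := fun i => (hS' i).sub hSi
    have hsum : Integrable (fun ω => ∑ i ∈ Sᶜ, (minAge (insert i S) (Finset.insert_nonempty i S)
        (X t ω) - minAge S hS (X t ω))) P :=
      integrable_finsetSum _ fun i _ => hdiff i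
    have hmul : ∀ e, symmetricRate (T.graph n) le l fn e *
        ∫ ω, (minAge S hS (e.transition (X t ω)) - minAge S hS (X t ω)) ∂P =
        ∫ ω, symmetricRate (T.graph n) le l fn e *
          (minAge S hS (e.transition (X t ω)) - minAge S hS (X t ω)) ∂P :=
      fun e => (integral_const_mul _ _).symm
    simp_rw [hmul]
    rw [← integral_finsetSum _ fun e _ =>
      (h.integrable_transition_sub hr t hS e).const_mul _]
    simp_rw [sum_symmetricRate_mul]
    rw [integral_add (f := fun ω => le - S.card * (l / n + l / fn) * minAge S hS (X t ω))
      ((integrable_const _).sub (hSi.const_mul _)) (hsum.const_mul _),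
      integral_sub (integrable_const _) (hSi.const_mul _), integral_const_mul, integral_const_mul,
      integral_finsetSum _ fun i _ => hdiff i]
    simp_rw [integral_sub (hS' _) hSi]
    rw [Finset.sum_sub_distrib, Finset.sum_const, nsmul_eq_mul, hcompl]
    simp only [integral_const, probReal_univ, one_smul, g]
    ring
  have hlim : Tendsto g atTop (𝓝 (S.card * (a + m * b) * steadyMinAge le a b n m)) := by
    have hn' : (n : ℝ) = S.card + m := by exact_mod_cast hm.symm
    have hcn : (n : ℝ) - m = S.card := by linarith
    cases m with
    | zero =>
      have hempty : Sᶜ = ∅ := Finset.card_eq_zero.1 (by exact_mod_cast hcompl)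
      have : S.card * (a + (0 : ℕ) * b) * steadyMinAge le a b n 0 = le := by
        rw [steadyMinAge, hn']
        push_cast
        field_simp
        ring
      rw [this]
      simp [g, hempty]
    | succ m =>
      have hsum : Tendsto (fun t => ∑ i ∈ Sᶜ,
          ∫ ω, minAge (insert i S) (Finset.insert_nonempty i S) (X t ω) ∂P) atTop
          (𝓝 (∑ i ∈ Sᶜ, steadyMinAge le a b n m)) := by
        refine tendsto_finsetSum _ fun i hi => tendsto_integral_minAge hn hle hl hfn h m _ ?_
        rw [Finset.card_insert_of_notMem (Finset.mem_compl.1 hi)]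
        omega
      convert (hsum.const_mul (S.card * b)).const_add le using 2
      have hden : a + ((m : ℝ) + 1) * b ≠ 0 := by positivity
      rw [Finset.sum_const, nsmul_eq_mul, hcompl, steadyMinAge, ← hcn]
      push_cast at hcn ⊢
      rw [hcn]
      field_simp
  have hcont := h.continuous_integral_minAge hr hS
  have hlim' := tendsto_of_hasDerivWithinAt_linear
    (f := fun x => ∫ ω, minAge S hS (X x.toNNReal ω) ∂P) (g := fun x => g x.toNNReal)
    (a := S.card * (a + m * b)) (by positivity)
    (hcont.comp continuous_real_toNNReal).continuousOn
    (fun x hx => hasDerivWithinAt_of_abs_sub_le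
      (V := fun t => ∫ ω, minAge S hS (X t ω) ∂P)
      (D := fun t => g t - S.card * (a + m * b) * ∫ ω, minAge S hS (X t ω) ∂P)
      (fun s t hst => by rw [← hgen]; exact h.abs_integral_minAge_sub_le hr hst hS) hx)
    (hlim.comp tendsto_real_toNNReal_atTop)
  rw [mul_div_cancel_left₀ _ (by positivity)] at hlim'
  have := hlim'.comp (NNReal.tendsto_coe_atTop.2 tendsto_id)
  simpa [Function.comp_def] using this

end IsVersionAgeProcess

end SteadyState

/-! ### Estimates for the steady-state recursion -/

section Bounds

variable {le a b : ℝ} {n : ℕ}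

lemma steadyMinAge_succ_mul (ha : 0 < a) (hb : 0 ≤ b) {m : ℕ} (hm : m + 1 < n) :
    steadyMinAge le a b n (m + 1) * (a + (m + 1) * b) =
      le / ((n : ℝ) - (m + 1)) + (m + 1) * b * steadyMinAge le a b n m := by
  have hk : (0 : ℝ) < (n : ℝ) - (m + 1) := sub_pos.2 (by exact_mod_cast hm)
  have hden : a + ((m : ℝ) + 1) * b ≠ 0 := by positivity
  rw [steadyMinAge]
  field_simp

lemma steadyMinAge_nonneg (hle : 0 ≤ le) (ha : 0 < a) (hb : 0 ≤ b) {m : ℕ} (hm : m < n) :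
    0 ≤ steadyMinAge le a b n m := by
  induction m with
  | zero => rw [steadyMinAge]; positivity
  | succ m ih =>
    have hk : (0 : ℝ) < (n : ℝ) - (m + 1) := sub_pos.2 (by exact_mod_cast hm)
    have := ih (by omega)
    rw [steadyMinAge]
    positivity

/-- By the recursion, `a * w_{m+1}` is the average of `le / (n - (m + 1))` and `a * w_m` with
weights `a` and `(m + 1) * b`, and inductively the latter is no larger than the former. -/
lemma mul_steadyMinAge_le (hle : 0 ≤ le) (ha : 0 < a) (hb : 0 ≤ b) {m : ℕ} (hm : m < n) :
    a * steadyMinAge le a b n m ≤ le / ((n : ℝ) - m) := by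
  induction m with
  | zero =>
    have : (0 : ℝ) < n := by exact_mod_cast hm
    rw [steadyMinAge]
    refine le_of_eq ?_
    rw [Nat.cast_zero, sub_zero]
    field_simp
  | succ m ih =>
    have hk : (0 : ℝ) < (n : ℝ) - (m + 1) := sub_pos.2 (by exact_mod_cast hm)
    have h1 := ih (by omega)
    have h2 : le / ((n : ℝ) - m) ≤ le / ((n : ℝ) - (m + 1)) :=
      div_le_div_of_nonneg_left hle hk (by linarith)
    have h3 := steadyMinAge_succ_mul (le := le) ha hb hm
    have hden : 0 < a + ((m : ℝ) + 1) * b := by positivity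
    push_cast
    refine le_of_mul_le_mul_right ?_ hden
    have h4 := mul_le_mul_of_nonneg_left (h1.trans h2) (by positivity : 0 ≤ ((m : ℝ) + 1) * b)
    calc _ = a * (le / ((n : ℝ) - (m + 1))) +
          ((m : ℝ) + 1) * b * (a * steadyMinAge le a b n m) := by rw [mul_assoc, h3]; ring
      _ ≤ _ := by linarith

lemma steadyMinAge_le_succ (hle : 0 ≤ le) (ha : 0 < a) (hb : 0 ≤ b) {m : ℕ} (hm : m + 1 < n) :
    steadyMinAge le a b n m ≤ steadyMinAge le a b n (m + 1) := by
  have hk : (0 : ℝ) < (n : ℝ) - (m + 1) := sub_pos.2 (by exact_mod_cast hm)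
  have h1 := mul_steadyMinAge_le hle ha hb (by omega : m < n)
  have h2 : le / ((n : ℝ) - m) ≤ le / ((n : ℝ) - (m + 1)) :=
    div_le_div_of_nonneg_left hle hk (by linarith)
  have h3 := steadyMinAge_succ_mul (le := le) ha hb hm
  have hden : 0 < a + ((m : ℝ) + 1) * b := by positivity
  refine le_of_mul_le_mul_right ?_ hden
  rw [h3]
  linarith

/-- The source contact supplies the extra `q` that turns the coefficient `m + 1` of `w_{m+1}` into
`m + 2`, so `(m + 1) q w_m` telescopes. The leftovers `p w_{m+1}` and `(m + 1) g (w_{m+1} - w_m)`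
are nonnegative and are dropped. -/
lemma contact_mul_steadyMinAge_le {p q g : ℝ} (hle : 0 ≤ le) (hp : 0 ≤ p) (hq : 0 < q)
    (hg : 0 ≤ g) {m : ℕ} (hm : m < n) :
    (m + 1) * q * steadyMinAge le (p + q) (g + q) n m ≤
      le * ∑ j ∈ Finset.range (m + 1), ((n : ℝ) - j)⁻¹ := by
  have ha : 0 < p + q := by positivity
  have hb : 0 ≤ g + q := by positivity
  induction m with
  | zero =>
    have h1 := mul_steadyMinAge_le hle ha hb hm
    have h2 := mul_nonneg hp (steadyMinAge_nonneg hle ha hb hm)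
    simp only [CharP.cast_eq_zero, sub_zero, zero_add, Finset.range_one, Finset.sum_singleton,
      one_mul, ← div_eq_mul_inv] at h1 ⊢
    linarith
  | succ m ih =>
    have h1 := ih (by omega)
    have h2 := steadyMinAge_succ_mul (le := le) ha hb hm
    have h3 := mul_nonneg (by positivity : 0 ≤ ((m : ℝ) + 1) * g)
      (sub_nonneg.2 (steadyMinAge_le_succ hle ha hb hm))
    have h4 := mul_nonneg hp (steadyMinAge_nonneg hle ha hb hm)
    rw [Finset.sum_range_succ, mul_add, ← div_eq_mul_inv]
    push_cast
    linarith

lemma sum_range_inv_sub (n : ℕ) :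
    ∑ j ∈ Finset.range n, ((n : ℝ) - j)⁻¹ = (harmonic n : ℝ) := by
  rw [harmonic, ← Finset.sum_range_reflect]
  push_cast
  refine Finset.sum_congr rfl fun j hj => ?_
  rw [Finset.mem_range] at hj
  congr 1
  rw [Nat.sub_sub, Nat.cast_sub (by omega)]
  push_cast
  ring

end Bounds

/-! ### The age of a single node and the three regimes -/

/-- The steady-state mean age of a node, when two entities meet at rate `l / fn`. -/
noncomputable def steadyAge (T : GossipTopology) (le l fn : ℝ) (n : ℕ) : ℝ :=
  steadyMinAge le (l / n + l / fn) (gossipRate T n l + l / fn) n (n - 1)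

lemma isSteadyStateAge_steadyAge (T : GossipTopology) {le l fn : ℝ} (hle : 0 ≤ le) (hl : 0 < l)
    (hfn : 0 ≤ fn) {n : ℕ} (hn : 1 ≤ n) :
    IsSteadyStateAge.{u} (symmetricRate (T.graph n) le l fn) (steadyAge T le l fn n) := by
  intro Ω mΩ P _ ℱ N X h i
  refine ⟨fun t => h.integrable_age (symmetricRate_nonneg T hn hle hl.le hfn) t i, ?_⟩
  have := h.tendsto_integral_minAge hn hle hl hfn (n - 1) (Finset.singleton_nonempty i)
    (by rw [Finset.card_singleton]; omega)
  simpa [minAge, steadyAge] using this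

lemma steadyAge_nonneg (T : GossipTopology) {le l fn : ℝ} (hle : 0 ≤ le) (hl : 0 < l)
    (hfn : 0 ≤ fn) {n : ℕ} (hn : 1 ≤ n) : 0 ≤ steadyAge T le l fn n := by
  have h1 := gossipRate_nonneg T hn hl.le
  have h2 : (0 : ℝ) < n := by exact_mod_cast hn
  exact steadyMinAge_nonneg hle (by positivity) (by positivity) (by omega)

lemma steadyAge_le (T : GossipTopology) {le l fn : ℝ} (hle : 0 ≤ le) (hl : 0 < l)
    (hfn : 0 < fn) {n : ℕ} (hn : 1 ≤ n) :
    steadyAge T le l fn n ≤ fn / n * (le * (Real.log n + 1)) / l := by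
  have h1 := gossipRate_nonneg T hn hl.le
  have h2 : (0 : ℝ) < n := by exact_mod_cast hn
  have h3 := contact_mul_steadyMinAge_le (n := n) (p := l / n) (q := l / fn) hle (by positivity)
    (by positivity) h1 (by omega : n - 1 < n)
  rw [Nat.sub_add_cancel hn, sum_range_inv_sub, Nat.cast_sub hn, Nat.cast_one,
    sub_add_cancel] at h3
  have h4 := h3.trans (mul_le_mul_of_nonneg_left (harmonic_le_one_add_log n) hle)
  change n * (l / fn) * steadyAge T le l fn n ≤ _ at h4
  rw [le_div_iff₀ hl, div_mul_eq_mul_div, le_div_iff₀ h2]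
  calc _ = fn * (n * (l / fn) * steadyAge T le l fn n) := by field_simp
    _ ≤ _ := by rw [add_comm (Real.log n)]; exact mul_le_mul_of_nonneg_left h4 hfn.le

lemma half_le_log {n : ℕ} (hn : 2 ≤ n) : 1 / 2 ≤ Real.log n := by
  have h1 : Real.log 2 ≤ Real.log n := Real.log_le_log two_pos (by exact_mod_cast hn)
  have h2 := Real.log_two_gt_d9
  linarith

lemma steadyAge_isBigO (T : GossipTopology) {le l : ℝ} (hle : 0 ≤ le) (hl : 0 < l) {fn : ℕ → ℝ}
    (hfn : ∀ n, 2 ≤ n → 0 < fn n) :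
    (fun n => steadyAge T le l (fn n) n) =O[atTop] fun n : ℕ => fn n / n * Real.log n := by
  -- The constant 3 comes from `log n + 1 ≤ 3 log n`, valid since `log n ≥ 1 / 2` for `n ≥ 2`.
  refine IsBigO.of_bound (3 * le / l) ?_
  filter_upwards [eventually_ge_atTop 2] with n hn
  have h1 := half_le_log hn
  have h2 := hfn n hn
  rw [Real.norm_of_nonneg (steadyAge_nonneg T hle hl h2.le (by omega)),
    Real.norm_of_nonneg (by positivity)]
  refine (steadyAge_le T hle hl h2 (by omega)).trans ?_
  calc _ ≤ fn n / n * (le * (3 * Real.log n)) / l := by gcongr; linarith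
    _ = _ := by ring

theorem lemma1 (T : GossipTopology) (le l : ℝ) (hle : 0 < le) (hl : 0 < l) :
    (∃ v : ℕ → ℝ,
      (∀ n : ℕ, 2 ≤ n →
        IsSteadyStateAge.{u} (symmetricRate (T.graph n) le l (n : ℝ)) (v n) ∧
        v n ≤ le * (Real.log n + 1) / l) ∧
      v =O[atTop] fun n : ℕ => Real.log n) ∧
    (∀ c : ℝ, 0 < c → ∃ v : ℕ → ℝ,
      (∀ n : ℕ, 2 ≤ n →
        IsSteadyStateAge.{u} (symmetricRate (T.graph n) le l (c * Real.log n)) (v n) ∧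
        v n ≤ (c * le * Real.log n ^ 2 / n + c * le * Real.log n / n
          + c * le * Real.log n / (n * (n + c * Real.log n))) / l) ∧
      v =O[atTop] fun n : ℕ => Real.log n ^ 2 / n) ∧
    (∀ c : ℝ, 0 < c → ∃ v : ℕ → ℝ,
      (∀ n : ℕ, 2 ≤ n →
        IsSteadyStateAge.{u} (symmetricRate (T.graph n) le l c) (v n) ∧
        v n ≤ (c * le * (Real.log n + 1) / n + c * le / (n * (c + n))) / l) ∧
      v =O[atTop] fun n : ℕ => Real.log n / n) := by
  refine ⟨⟨fun n => steadyAge T le l n n, fun n hn => ?_, ?_⟩,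
    fun c hc => ⟨fun n => steadyAge T le l (c * Real.log n) n, fun n hn => ?_, ?_⟩,
    fun c hc => ⟨fun n => steadyAge T le l c n, fun n hn => ?_, ?_⟩⟩
  · have h0 : (0 : ℝ) < n := by exact_mod_cast (by omega : 0 < n)
    refine ⟨isSteadyStateAge_steadyAge T hle.le hl h0.le (by omega), ?_⟩
    have := steadyAge_le T hle.le hl h0 (by omega : 1 ≤ n)
    rwa [div_self h0.ne', one_mul] at this
  · refine (steadyAge_isBigO T hle.le hl fun n hn => by
      exact_mod_cast (by omega : 0 < n)).congr' .rfl ?_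
    filter_upwards [eventually_ge_atTop 2] with n hn
    have h0 : (n : ℝ) ≠ 0 := by exact_mod_cast (by omega : n ≠ 0)
    rw [div_self h0, one_mul]
  · have h0 : (0 : ℝ) < n := by exact_mod_cast (by omega : 0 < n)
    have h1 := half_le_log hn
    refine ⟨isSteadyStateAge_steadyAge T hle.le hl (by positivity) (by omega),
      (steadyAge_le T hle.le hl (by positivity) (by omega)).trans ?_⟩
    gcongr
    -- The last term of the claimed bound is pure slack: the estimate already holds without it.
    have h2 : 0 ≤ c * le * Real.log n / (n * (n + c * Real.log n)) := by positivity
    calc _ = c * le * Real.log n ^ 2 / n + c * le * Real.log n / n := by ring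
      _ ≤ _ := le_add_of_nonneg_right h2
  · refine ((steadyAge_isBigO T hle.le hl (fn := fun n => c * Real.log n) fun n hn =>
      mul_pos hc (by linarith [half_le_log hn])).congr_right fun n => ?_).trans
      (isBigO_const_mul_self c _ _)
    ring
  · have h0 : (0 : ℝ) < n := by exact_mod_cast (by omega : 0 < n)
    refine ⟨isSteadyStateAge_steadyAge T hle.le hl hc.le (by omega),
      (steadyAge_le T hle.le hl hc (by omega)).trans ?_⟩
    gcongr
    have h2 : 0 ≤ c * le / (n * (c + n)) := by positivity
    calc _ = c * le * (Real.log n + 1) / n := by ring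
      _ ≤ _ := le_add_of_nonneg_right h2
  · refine ((steadyAge_isBigO T hle.le hl (fn := fun _ => c) fun n hn => hc).congr_right
      fun n => ?_).trans (isBigO_const_mul_self c _ _)
    ring
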